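/- Let $S$ be a nonempty finite semigroup. For $s\in S$ let $\overline{s}$ be the transformation of the set $S^{\infty}$ of infinite sequences over $S$ induced by the state $s$ of the Cayley automaton of $S$ (state set $S$, alphabet $S$; in state $s$, on reading $t$, it outputs $st$ and moves to state $st$), that is, $$\overline{s}\colon x_1x_2x_3\cdots\mapsto (sx_1)(sx_1x_2)(sx_1x_2x_3)\cdots,$$ and let $\mathbf{C}(S)$ be the semigroup of transformations of $S^{\infty}$ generated by $\{\overline{s}: s\in S\}$. Let $K$ be the minimal (two-sided) ideal of $S$. Then $\mathbf{C}(S)$ is a free semigroup if and only if the following three conditions hold: 1. $K$ consists of a single $\mathcal{R}$-class of $S$; 2. every $\mathcal{H}$-class contained in $K$ has more than one element; 3. there exists $k\in K$ such that $st=skt$ for all $s,t\in S$. In that case, $\mathbf{C}(S)$ is free of rank $|H|$ for every $\mathcal{H}$-class $H$ of $S$ contained in $K$. (Here $\mathcal{R}$, $\mathcal{L}$ and $\mathcal{H}=\mathcal{R}\cap\mathcal{L}$ are Green's relations: $a\,\mathcal{R}\,b$ iff $aS\cup\{a\}=bS\cup\{b\}$, and $a\,\mathcal{L}\,b$ iff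 $Sa\cup\{a\}=Sb\cup\{b\}$.) -/

import Mathlib

universe u v

/-- A (complete, deterministic, synchronous) automaton with state set `Q` over the alphabet `A`. -/
structure MealyAutomaton (Q : Type u) (A : Type v) where
  /-- `next q x` is the state reached from the state `q` on reading the symbol `x`. -/
  next : Q → A → Q
  /-- `out q x` is the symbol written in the state `q` on reading the symbol `x`. -/
  out : Q → A → A

namespace MealyAutomaton

variable {Q : Type u} {A : Type v}

/-- The state reached from `q` after reading the first `n` symbols of the infinite sequence `w`. -/
def stateAt (M : MealyAutomaton Q A) (q : Q) (w : ℕ → A) : ℕ → Q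
  | 0 => q
  | n + 1 => M.next (M.stateAt q w n) (w n)

/-- The transformation of the set of infinite sequences over `A` given by the initial state `q`. -/
def act (M : MealyAutomaton Q A) (q : Q) (w : ℕ → A) : ℕ → A :=
  fun n => M.out (M.stateAt q w n) (w n)

/-- The state `q` as an element of the semigroup of transformations of infinite sequences.
Transformations act on the right, that is, `f * g` means "first `f`, then `g`"; this is the
opposite of `Function.End`, whose product is `f ∘ g`. -/
def state (M : MealyAutomaton Q A) (q : Q) : (Function.End (ℕ → A))ᵐᵒᵖ :=
  MulOpposite.op (M.act q)

/-- The automaton semigroup: the semigroup of transformations generated by all states. -/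
def semigroup (M : MealyAutomaton Q A) : Subsemigroup (Function.End (ℕ → A))ᵐᵒᵖ :=
  Subsemigroup.closure (Set.range M.state)

end MealyAutomaton

/-- The Cayley automaton of `S`: in the state `s`, on reading `t`, it moves to the state `s * t`
and writes the symbol `s * t`. -/
def cayleyAutomaton (S : Type u) [Semigroup S] : MealyAutomaton S S where
  next s t := s * t
  out s t := s * t

/-- The Cayley automaton semigroup of `S`. -/
def CayleyAutomatonSemigroup (S : Type u) [Semigroup S] :
    Subsemigroup (Function.End (ℕ → S))ᵐᵒᵖ :=
  (cayleyAutomaton S).semigroup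

/-- `T` is a free semigroup. (A free basis embeds into `T`, so the universe of `T` suffices.) -/
def IsFreeSemigroup (T : Type u) [Semigroup T] : Prop :=
  ∃ X : Type u, Nonempty (FreeSemigroup X ≃* T)

/-- `T` is a free semigroup of rank `n`. -/
def IsFreeSemigroupOfRank (T : Type u) [Semigroup T] (n : ℕ) : Prop :=
  Nonempty (FreeSemigroup (Fin n) ≃* T)

section Green

variable {S : Type u} [Semigroup S]

/-- A (nonempty, two-sided) ideal of a semigroup. -/
structure IsSemigroupIdeal (I : Set S) : Prop where
  nonempty : I.Nonempty
  mul_mem_left : ∀ s : S, ∀ a ∈ I, s * a ∈ I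
  mul_mem_right : ∀ a ∈ I, ∀ s : S, a * s ∈ I

/-- `K` is the minimal ideal of `S`: minimal with respect to inclusion among the ideals. -/
def IsMinimalIdeal (K : Set S) : Prop :=
  Minimal IsSemigroupIdeal K

/-- The principal right ideal `a S¹ = {a} ∪ a S`. -/
def principalRightIdeal (a : S) : Set S :=
  {b | b = a ∨ ∃ s, b = a * s}

/-- The principal left ideal `S¹ a = {a} ∪ S a`. -/
def principalLeftIdeal (a : S) : Set S :=
  {b | b = a ∨ ∃ s, b = s * a}

/-- The class of `a` under Green's relation `R`: generating the same principal right ideal. -/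
def greenRClass (a : S) : Set S :=
  {b | principalRightIdeal b = principalRightIdeal a}

/-- The class of `a` under Green's relation `L`: generating the same principal left ideal. -/
def greenLClass (a : S) : Set S :=
  {b | principalLeftIdeal b = principalLeftIdeal a}

/-- The class of `a` under Green's relation `H`, the intersection of `R` and `L`. -/
def greenHClass (a : S) : Set S :=
  greenRClass a ∩ greenLClass a

/-- A nonempty finite semigroup has exactly one minimal ideal. -/
theorem existsUnique_isMinimalIdeal (S : Type u) [Semigroup S] [Finite S] [Nonempty S] :
    ∃! K : Set S, IsMinimalIdeal K := by
  have hU : IsSemigroupIdeal (Set.univ : Set S) :=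
    ⟨Set.univ_nonempty, fun _ _ _ => trivial, fun _ _ _ => trivial⟩
  obtain ⟨K, hK⟩ := (Set.toFinite {I : Set S | IsSemigroupIdeal I}).exists_minimal ⟨_, hU⟩
  have key : ∀ I J : Set S, IsSemigroupIdeal I → IsMinimalIdeal J → J ⊆ I := by
    intro I J hI hJ
    obtain ⟨a, ha⟩ := hI.nonempty
    obtain ⟨b, hb⟩ := hJ.prop.nonempty
    have hIJ : IsSemigroupIdeal (I ∩ J) :=
      ⟨⟨a * b, hI.mul_mem_right a ha b, hJ.prop.mul_mem_left a b hb⟩,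
        fun s x hx => ⟨hI.mul_mem_left s x hx.1, hJ.prop.mul_mem_left s x hx.2⟩,
        fun x hx s => ⟨hI.mul_mem_right x hx.1 s, hJ.prop.mul_mem_right x hx.2 s⟩⟩
    exact (hJ.le_of_le hIJ Set.inter_subset_right).trans Set.inter_subset_left
  exact ⟨K, hK, fun J hJ => (key K J hK.prop hJ).antisymm (key J K hJ.prop hK)⟩

end Green

/-!
A minimal ideal `K` that is an `R`-class and contains an idempotent is a right group: its
idempotents are left identities of `K`, and its `H`-classes are the groups `e S e` with `e ∈ K`
idempotent. If moreover `s t = s k t` for some `k ∈ K`, then `s e x = s x` for all `x`, so the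
state `s` acts like the element `s e` of `e S e`, and the words in the states may be compared
over the group `G = e S e`. There the operator `(z n)⁻¹ * z (n + 1)` undoes each state up to a
shift of the sequence. Hence it recovers the length of a word from its action, and then, letter
by letter, the word itself, as soon as `G` is nontrivial.

Conversely, cancelling states in a free Cayley automaton semigroup gives `s e t = s t` and
`e s t = s t` for every idempotent `e`, which forces `K` to be an `R`-class. A trivial `H`-class
`{e}` in `K` would make the state `e` an idempotent, and free semigroups have none.
-/

section FreeSemigroup

variable {X : Type u} {Y : Type v}

/-- The isomorphism of free semigroups induced by a bijection of their bases. -/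
def freeSemigroupCongr (f : X ≃ Y) : FreeSemigroup X ≃* FreeSemigroup Y :=
  MulHom.toMulEquiv (FreeSemigroup.map f) (FreeSemigroup.map f.symm)
    (FreeSemigroup.hom_ext (funext fun _ => by simp))
    (FreeSemigroup.hom_ext (funext fun _ => by simp))

theorem srange_freeSemigroup_lift {T : Type v} [Semigroup T] (f : X → T) :
    (FreeSemigroup.lift f).srange = Subsemigroup.closure (Set.range f) := by
  refine le_antisymm ?_ (Subsemigroup.closure_le.mpr ?_)
  · rintro _ ⟨p, rfl⟩
    induction p with
    | ih1 i => exact Subsemigroup.subset_closure ⟨i, rfl⟩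
    | ih2 i p hi hp => rw [map_mul]; exact mul_mem hi hp
  · rintro _ ⟨i, rfl⟩
    exact ⟨FreeSemigroup.of i, rfl⟩

theorem nonempty_freeSemigroup_mulEquiv_closure {T : Type v} [Semigroup T] {f : X → T}
    (hf : Function.Injective (FreeSemigroup.lift f)) :
    Nonempty (FreeSemigroup X ≃* Subsemigroup.closure (Set.range f)) := by
  rw [← srange_freeSemigroup_lift]
  exact ⟨MulEquiv.ofBijective (FreeSemigroup.lift f).srangeRestrict
    ⟨fun _ _ h => hf (congrArg Subtype.val h), MulHom.srangeRestrict_surjective _⟩⟩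

theorem IsFreeSemigroup.isCancelMul {T : Type u} [Semigroup T] (h : IsFreeSemigroup T) :
    IsCancelMul T := by
  obtain ⟨X, ⟨φ⟩⟩ := h
  exact (FreeSemigroup.toFreeMonoid_injective.comp φ.symm.injective).isCancelMul _
    (map_mul (FreeSemigroup.toFreeMonoid.comp φ.symm.toMulHom))

theorem IsFreeSemigroup.not_isIdempotentElem {T : Type u} [Semigroup T] (h : IsFreeSemigroup T)
    (t : T) : ¬IsIdempotentElem t := by
  obtain ⟨X, ⟨φ⟩⟩ := h
  intro ht
  have hmul := ht.map (FreeSemigroup.toFreeMonoid.comp φ.symm.toMulHom)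
  exact FreeSemigroup.toFreeMonoid_ne_one _ (mul_eq_left.mp hmul.eq)

end FreeSemigroup

section CayleyAction

variable {S : Type u} [Semigroup S]

theorem cayley_act_zero (s : S) (x : ℕ → S) : (cayleyAutomaton S).act s x 0 = s * x 0 := rfl

theorem cayley_act_succ (s : S) (x : ℕ → S) (n : ℕ) :
    (cayleyAutomaton S).act s x (n + 1) = (cayleyAutomaton S).act s x n * x (n + 1) := rfl

theorem cayley_act_mul (s t : S) (x : ℕ → S) (n : ℕ) :
    (cayleyAutomaton S).act (s * t) x n = s * (cayleyAutomaton S).act t x n := by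
  induction n with
  | zero => exact mul_assoc _ _ _
  | succ n ih => rw [cayley_act_succ, ih, cayley_act_succ, mul_assoc]

theorem cayley_act_map {T : Type v} [Semigroup T] (f : S →ₙ* T) (s : S) (x : ℕ → S) :
    (cayleyAutomaton T).act (f s) (f ∘ x) = f ∘ (cayleyAutomaton S).act s x := by
  funext n
  induction n with
  | zero => exact (map_mul f _ _).symm
  | succ n ih => rw [cayley_act_succ, ih]; exact (map_mul f _ _).symm

theorem cayley_act_congr_state {s t : S} {x : ℕ → S} (h : s * x 0 = t * x 0) :
    (cayleyAutomaton S).act s x = (cayleyAutomaton S).act t x := by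
  funext n
  induction n with
  | zero => exact h
  | succ n ih => rw [cayley_act_succ, cayley_act_succ, ih]

theorem cayley_act_congr_input (s : S) {x y : ℕ → S} (h : ∀ t n, t * x n = t * y n) :
    (cayleyAutomaton S).act s x = (cayleyAutomaton S).act s y := by
  funext n
  induction n with
  | zero => exact h s 0
  | succ n ih => rw [cayley_act_succ, cayley_act_succ, ih, h]

theorem cayley_act_right_cancel [IsRightCancelMul S] {s t : S} {x : ℕ → S} {n : ℕ}
    (h : (cayleyAutomaton S).act s x n = (cayleyAutomaton S).act t x n) : s = t := by
  induction n with
  | zero => exact mul_right_cancel h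
  | succ n ih => exact ih (mul_right_cancel h)

theorem cayley_state_eq_iff {s t : S} :
    (cayleyAutomaton S).state s = (cayleyAutomaton S).state t ↔ ∀ x, s * x = t * x :=
  ⟨fun h x => congrFun (congrFun (MulOpposite.op_injective h) fun _ => x) 0,
    fun h => congrArg MulOpposite.op (funext fun _ => cayley_act_congr_state (h _))⟩

/-- The state `s` of the Cayley automaton, as an element of the Cayley automaton semigroup. -/
def cayleyState (s : S) : CayleyAutomatonSemigroup S :=
  ⟨(cayleyAutomaton S).state s, Subsemigroup.subset_closure ⟨s, rfl⟩⟩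

theorem cayleyState_eq_iff {s t : S} : cayleyState s = cayleyState t ↔ ∀ x, s * x = t * x :=
  Subtype.ext_iff.trans cayley_state_eq_iff

theorem cayleyState_mul_eq_mul {a b c d : S}
    (h : ∀ x, (cayleyAutomaton S).act b ((cayleyAutomaton S).act a x) =
      (cayleyAutomaton S).act d ((cayleyAutomaton S).act c x)) :
    cayleyState a * cayleyState b = cayleyState c * cayleyState d :=
  Subtype.ext (congrArg MulOpposite.op (funext h))

/-- The transformation of sequences given by a word in the states of the Cayley automaton, whose
first letter acts first. -/
def cayleyWordAct (p : FreeSemigroup S) : (ℕ → S) → ℕ → S :=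
  (FreeSemigroup.lift (cayleyAutomaton S).state p).unop

theorem cayleyWordAct_of_mul (s : S) (p : FreeSemigroup S) (x : ℕ → S) :
    cayleyWordAct (FreeSemigroup.of s * p) x =
      cayleyWordAct p ((cayleyAutomaton S).act s x) := by
  rw [cayleyWordAct, FreeSemigroup.lift_of_mul]
  rfl

theorem cayleyWordAct_map {T : Type v} [Semigroup T] (f : S →ₙ* T) (p : FreeSemigroup S)
    (x : ℕ → S) : cayleyWordAct (FreeSemigroup.map f p) (f ∘ x) = f ∘ cayleyWordAct p x := by
  induction p generalizing x with
  | ih1 s => exact cayley_act_map f s x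
  | ih2 s p _ ih =>
    rw [map_mul, FreeSemigroup.map_of, cayleyWordAct_of_mul, cayley_act_map, ih,
      cayleyWordAct_of_mul]

end CayleyAction

section CayleyGroup

variable {G : Type u} [Group G]

/-- The sequence of quotients of consecutive terms; it undoes the states of the Cayley automaton
of a group up to a shift, see `leftQuotient_cayley_act`. -/
def leftQuotient (z : ℕ → G) (n : ℕ) : G :=
  (z n)⁻¹ * z (n + 1)

theorem leftQuotient_cayley_act (g : G) (x : ℕ → G) (n : ℕ) :
    leftQuotient ((cayleyAutomaton G).act g x) n = x (n + 1) := by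
  rw [leftQuotient, cayley_act_succ, inv_mul_cancel_left]

theorem iterate_leftQuotient_cayleyWordAct (p : FreeSemigroup G) (x : ℕ → G) :
    leftQuotient^[p.length] (cayleyWordAct p x) = fun n => x (n + p.length) := by
  induction p generalizing x with
  | ih1 g => exact funext (leftQuotient_cayley_act g x)
  | ih2 g p _ ih =>
    funext n
    rw [FreeSemigroup.length_mul, FreeSemigroup.length_of, add_comm, Function.iterate_succ_apply',
      cayleyWordAct_of_mul, ih, ← add_assoc, ← leftQuotient_cayley_act g x]
    simp only [leftQuotient, add_right_comm]

theorem leftQuotient_mulSingle_zero (a : G) :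
    leftQuotient (Pi.mulSingle 0 a) = Pi.mulSingle 0 a⁻¹ := by
  funext n
  cases n <;> simp [leftQuotient]

theorem iterate_leftQuotient_mulSingle_zero_ne_one {a : G} (ha : a ≠ 1) (n : ℕ) :
    leftQuotient^[n] (Pi.mulSingle 0 a) ≠ 1 := by
  induction n generalizing a with
  | zero => simpa using ha
  | succ n ih =>
    rw [Function.iterate_succ_apply, leftQuotient_mulSingle_zero]
    exact ih (inv_ne_one.mpr ha)

theorem length_le_of_cayleyWordAct_eq [Nontrivial G] {p q : FreeSemigroup G}
    (h : cayleyWordAct p = cayleyWordAct q) : q.length ≤ p.length := by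
  by_contra! hlt
  obtain ⟨d, hd⟩ := Nat.exists_eq_add_of_lt hlt
  obtain ⟨a, ha⟩ := exists_ne (1 : G)
  have hp := iterate_leftQuotient_cayleyWordAct p (Pi.mulSingle p.length a)
  have hq := iterate_leftQuotient_cayleyWordAct q (Pi.mulSingle p.length a)
  have hp_shift :
      (fun n => (Pi.mulSingle p.length a : ℕ → G) (n + p.length)) = Pi.mulSingle 0 a := by
    classical
    funext n
    simp [Pi.mulSingle_apply]
  have hq_shift : (fun n => (Pi.mulSingle p.length a : ℕ → G) (n + q.length)) = 1 := by
    funext n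
    exact Pi.mulSingle_eq_of_ne (M := fun _ => G) (by omega) a
  rw [hq_shift, ← h, hd, add_assoc, add_comm, Function.iterate_add_apply, hp, hp_shift] at hq
  exact iterate_leftQuotient_mulSingle_zero_ne_one ha _ hq

theorem eq_of_cayleyWordAct_apply_eq {p q : FreeSemigroup G} (hl : p.length = q.length)
    {x : ℕ → G} (h : cayleyWordAct p x = cayleyWordAct q x) : p = q := by
  induction p generalizing q x with
  | ih1 g =>
    cases q using FreeSemigroup.recOnMul with
    | ih1 k => exact congrArg _ (cayley_act_right_cancel (s := g) (t := k) (congrFun h 0))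
    | ih2 k q => simp [FreeSemigroup.length] at hl
  | ih2 g p _ ih =>
    cases q using FreeSemigroup.recOnMul with
    | ih1 k => simp [FreeSemigroup.length] at hl
    | ih2 k q =>
      have hl' : p.length = q.length := by simpa using hl
      rw [cayleyWordAct_of_mul, cayleyWordAct_of_mul] at h
      have hact := iterate_leftQuotient_cayleyWordAct p ((cayleyAutomaton G).act g x)
      rw [h, hl', iterate_leftQuotient_cayleyWordAct] at hact
      obtain rfl := cayley_act_right_cancel (congrFun hact 0)
      rw [ih hl' h]

theorem cayleyWordAct_injective [Nontrivial G] :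
    Function.Injective (cayleyWordAct (S := G)) := fun _ _ h =>
  eq_of_cayleyWordAct_apply_eq ((length_le_of_cayleyWordAct_eq h.symm).antisymm
    (length_le_of_cayleyWordAct_eq h)) (congrFun h 1)

theorem nonempty_freeSemigroup_mulEquiv_of_state_eq [Nontrivial G] {S : Type v} [Semigroup S]
    {f : G →ₙ* S} (hf : Function.Injective f)
    (hs : ∀ s, ∃ g, (cayleyAutomaton S).state (f g) = (cayleyAutomaton S).state s) :
    Nonempty (FreeSemigroup G ≃* CayleyAutomatonSemigroup S) := by
  have hrange : Set.range ((cayleyAutomaton S).state ∘ f) = Set.range (cayleyAutomaton S).state :=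
    (Set.range_comp_subset_range _ _).antisymm (Set.range_subset_iff.mpr hs)
  have hlift : FreeSemigroup.lift ((cayleyAutomaton S).state ∘ f) =
      (FreeSemigroup.lift (cayleyAutomaton S).state).comp (FreeSemigroup.map f) :=
    FreeSemigroup.hom_ext rfl
  rw [CayleyAutomatonSemigroup, MealyAutomaton.semigroup, ← hrange]
  refine nonempty_freeSemigroup_mulEquiv_closure fun p q hpq => ?_
  rw [hlift, MulHom.comp_apply, MulHom.comp_apply] at hpq
  refine cayleyWordAct_injective (funext fun x => hf.comp_left ?_)
  change f ∘ cayleyWordAct p x = f ∘ cayleyWordAct q x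
  rw [← cayleyWordAct_map, ← cayleyWordAct_map, cayleyWordAct, hpq, cayleyWordAct]

end CayleyGroup

section GreenRelations

variable {S : Type u} [Semigroup S] {a b c e : S}

theorem principalRightIdeal_subset (h : a ∈ principalRightIdeal b) :
    principalRightIdeal a ⊆ principalRightIdeal b := by
  rintro _ (rfl | ⟨s, rfl⟩)
  · exact h
  · obtain rfl | ⟨t, rfl⟩ := h
    · exact Or.inr ⟨s, rfl⟩
    · exact Or.inr ⟨t * s, mul_assoc _ _ _⟩

theorem principalLeftIdeal_subset (h : a ∈ principalLeftIdeal b) :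
    principalLeftIdeal a ⊆ principalLeftIdeal b := by
  rintro _ (rfl | ⟨s, rfl⟩)
  · exact h
  · obtain rfl | ⟨t, rfl⟩ := h
    · exact Or.inr ⟨s, rfl⟩
    · exact Or.inr ⟨s * t, (mul_assoc _ _ _).symm⟩

theorem mem_greenRClass_iff :
    b ∈ greenRClass a ↔ b ∈ principalRightIdeal a ∧ a ∈ principalRightIdeal b :=
  ⟨fun h => ⟨h.le (Or.inl rfl), h.ge (Or.inl rfl)⟩,
    fun h => (principalRightIdeal_subset h.1).antisymm (principalRightIdeal_subset h.2)⟩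

theorem mem_greenLClass_iff :
    b ∈ greenLClass a ↔ b ∈ principalLeftIdeal a ∧ a ∈ principalLeftIdeal b :=
  ⟨fun h => ⟨h.le (Or.inl rfl), h.ge (Or.inl rfl)⟩,
    fun h => (principalLeftIdeal_subset h.1).antisymm (principalLeftIdeal_subset h.2)⟩

theorem greenRClass_eq_of_mem (h : b ∈ greenRClass a) : greenRClass b = greenRClass a :=
  Set.ext fun _ => ⟨fun hb => hb.trans h, fun hb => hb.trans h.symm⟩

theorem greenLClass_eq_of_mem (h : b ∈ greenLClass a) : greenLClass b = greenLClass a :=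
  Set.ext fun _ => ⟨fun hb => hb.trans h, fun hb => hb.trans h.symm⟩

theorem mul_eq_of_mem_principalRightIdeal (he : IsIdempotentElem e)
    (ha : a ∈ principalRightIdeal e) : e * a = a := by
  obtain rfl | ⟨s, rfl⟩ := ha
  · exact he
  · rw [← mul_assoc, he.eq]

theorem mul_eq_of_mem_principalLeftIdeal (he : IsIdempotentElem e)
    (ha : a ∈ principalLeftIdeal e) : a * e = a := by
  obtain rfl | ⟨s, rfl⟩ := ha
  · exact he
  · rw [mul_assoc, he.eq]

theorem exists_mul_eq_of_mem_principalRightIdeal (he : IsIdempotentElem e)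
    (ha : e ∈ principalRightIdeal a) : ∃ s, a * s = e := by
  obtain rfl | ⟨s, rfl⟩ := ha
  · exact ⟨_, he⟩
  · exact ⟨s, rfl⟩

theorem exists_mul_eq_of_mem_principalLeftIdeal (he : IsIdempotentElem e)
    (ha : e ∈ principalLeftIdeal a) : ∃ s, s * a = e := by
  obtain rfl | ⟨s, rfl⟩ := ha
  · exact ⟨_, he⟩
  · exact ⟨s, rfl⟩

theorem greenHClass_subset_corner (he : IsIdempotentElem e) :
    greenHClass e ⊆ Subsemigroup.corner e := fun _ hg =>
  (Subsemigroup.mem_corner_iff he).mpr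
    ⟨mul_eq_of_mem_principalRightIdeal he (mem_greenRClass_iff.mp hg.1).1,
      mul_eq_of_mem_principalLeftIdeal he (mem_greenLClass_iff.mp hg.2).1⟩

/-- The group structure on `e S e` when `e` is an idempotent and all elements of `e S e` are
`H`-related to it: the maximal subgroup with identity `e`. -/
noncomputable abbrev cornerGroup (he : IsIdempotentElem e)
    (h : (Subsemigroup.corner e : Set S) ⊆ greenHClass e) : Group (Subsemigroup.corner e) :=
  have hinv (g : Subsemigroup.corner e) : ∃ s, s * g.1 = e :=
    exists_mul_eq_of_mem_principalLeftIdeal he (mem_greenLClass_iff.mp (h g.2).2).2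
  letI : One (Subsemigroup.corner e) := ⟨e, (Subsemigroup.mem_corner_iff he).mpr ⟨he, he⟩⟩
  letI : Inv (Subsemigroup.corner e) := ⟨fun g => ⟨e * (hinv g).choose * e, _, rfl⟩⟩
  Group.ofLeftAxioms mul_assoc
    (fun g => Subtype.ext ((Subsemigroup.mem_corner_iff he).mp g.2).1)
    (fun g => Subtype.ext <| show e * (hinv g).choose * e * g.1 = e by
      rw [mul_assoc, ((Subsemigroup.mem_corner_iff he).mp g.2).1, mul_assoc,
        (hinv g).choose_spec, he.eq])

theorem mem_principalRightIdeal_of_mem_greenRClass (ha : a ∈ greenRClass c)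
    (hb : b ∈ greenRClass c) : b ∈ principalRightIdeal a :=
  (mem_greenRClass_iff.mp (hb.trans ha.symm)).1

theorem exists_isIdempotentElem_mem_greenLClass (hK : IsSemigroupIdeal (greenRClass c))
    (he : IsIdempotentElem e) (hec : e ∈ greenRClass c) (ha : a ∈ greenRClass c) :
    ∃ f ∈ greenRClass c, IsIdempotentElem f ∧ f ∈ greenLClass a := by
  obtain ⟨s, hs⟩ := exists_mul_eq_of_mem_principalRightIdeal he
    (mem_principalRightIdeal_of_mem_greenRClass ha hec)
  have hea : e * a = a :=
    mul_eq_of_mem_principalRightIdeal he (mem_principalRightIdeal_of_mem_greenRClass hec ha)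
  refine ⟨s * a, hK.mul_mem_left s a ha, ?_,
    mem_greenLClass_iff.mpr ⟨Or.inr ⟨s, rfl⟩, Or.inr ⟨a, ?_⟩⟩⟩
  · rw [IsIdempotentElem, mul_assoc, ← mul_assoc a, hs, hea]
  · rw [← mul_assoc, hs, hea]

theorem greenHClass_eq_corner (hK : IsSemigroupIdeal (greenRClass c)) (he : IsIdempotentElem e)
    (hec : e ∈ greenRClass c) : greenHClass e = Subsemigroup.corner e := by
  refine (greenHClass_subset_corner he).antisymm fun g hg => ?_
  obtain ⟨heg, hge⟩ := (Subsemigroup.mem_corner_iff he).mp hg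
  have hgc : g ∈ greenRClass c := heg ▸ hK.mul_mem_right e hec g
  refine ⟨hgc.trans hec.symm, ?_⟩
  obtain ⟨f, hfc, hf, hfg⟩ := exists_isIdempotentElem_mem_greenLClass hK he hec hgc
  have hge' : g ∈ principalLeftIdeal e := Or.inr ⟨g, hge.symm⟩
  have hfe : f = e := calc
    f = f * e := (mul_eq_of_mem_principalLeftIdeal he
      (principalLeftIdeal_subset hge' (mem_greenLClass_iff.mp hfg).1)).symm
    _ = e := mul_eq_of_mem_principalRightIdeal hf
      (mem_principalRightIdeal_of_mem_greenRClass hfc hec)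
  exact (hfe ▸ hfg).symm

theorem exists_greenHClass_eq_corner (hK : IsSemigroupIdeal (greenRClass c))
    (he : IsIdempotentElem e) (hec : e ∈ greenRClass c) (ha : a ∈ greenRClass c) :
    ∃ f ∈ greenRClass c, IsIdempotentElem f ∧ greenHClass f = Subsemigroup.corner f ∧
      greenHClass a = Subsemigroup.corner f := by
  obtain ⟨f, hfc, hf, hfa⟩ := exists_isIdempotentElem_mem_greenLClass hK he hec ha
  have hH := greenHClass_eq_corner hK hf hfc
  refine ⟨f, hfc, hf, hH, ?_⟩
  rw [← hH, greenHClass, greenHClass, greenLClass_eq_of_mem hfa,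
    greenRClass_eq_of_mem (hfc.trans ha.symm)]

end GreenRelations

section MinimalIdeal

variable {S : Type u} [Semigroup S] {K : Set S}

theorem IsSemigroupIdeal.exists_isIdempotentElem [Finite S] (hK : IsSemigroupIdeal K) :
    ∃ e ∈ K, IsIdempotentElem e := by
  let : TopologicalSpace S := ⊥
  have : DiscreteTopology S := ⟨rfl⟩
  exact exists_idempotent_in_compact_subsemigroup (fun _ => continuous_of_discreteTopology) K
    hK.nonempty K.toFinite.isCompact fun a _ b hb => hK.mul_mem_left a b hb

theorem IsSemigroupIdeal.eq_greenRClass (hK : IsSemigroupIdeal K)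
    (h : ∀ a ∈ K, ∀ b ∈ K, b ∈ principalRightIdeal a) {a : S} (ha : a ∈ K) :
    K = greenRClass a := by
  ext b
  rw [mem_greenRClass_iff]
  refine ⟨fun hb => ⟨h a ha b hb, h b hb a ha⟩, ?_⟩
  rintro ⟨rfl | ⟨s, rfl⟩, -⟩
  · exact ha
  · exact hK.mul_mem_right a ha s

theorem IsMinimalIdeal.exists_eq_mul_mul (hK : IsMinimalIdeal K) {a b : S} (ha : a ∈ K)
    (hb : b ∈ K) : ∃ s t, a = s * b * t := by
  refine hK.le_of_le (y := {x | ∃ s t, x = s * b * t}) ⟨⟨_, b, b, rfl⟩, ?_, ?_⟩ ?_ ha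
  · rintro s _ ⟨t, u, rfl⟩
    exact ⟨s * t, u, by simp only [mul_assoc]⟩
  · rintro _ ⟨t, u, rfl⟩ s
    exact ⟨t, u * s, by simp only [mul_assoc]⟩
  · rintro _ ⟨t, u, rfl⟩
    exact hK.prop.mul_mem_right _ (hK.prop.mul_mem_left _ _ hb) _

theorem IsMinimalIdeal.eq_greenRClass_of_idempotent_mul (hK : IsMinimalIdeal K)
    (hm : ∀ e : S, IsIdempotentElem e → ∀ s t, s * e * t = s * t)
    (hl : ∀ e : S, IsIdempotentElem e → ∀ s t, e * s * t = s * t) {e : S}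
    (he : IsIdempotentElem e) (heK : e ∈ K) : K = greenRClass e := by
  refine hK.prop.eq_greenRClass (fun a ha b hb => ?_) heK
  obtain ⟨s, t, hst⟩ := hK.exists_eq_mul_mul heK ha
  obtain ⟨u, v, huv⟩ := hK.exists_eq_mul_mul hb hb
  have hidem : IsIdempotentElem (a * t * s) := calc
    a * t * s * (a * t * s) = a * t * (s * a * t) * s := by simp only [mul_assoc]
    _ = a * t * s := by rw [← hst, hm e he]
  refine Or.inr ⟨t * s * b, ?_⟩
  calc
    b = u * b * v := huv
    _ = a * t * s * (u * b) * v := (hl _ hidem _ _).symm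
    _ = a * (t * s * b) := by rw [mul_assoc _ (u * b), ← huv]; simp only [mul_assoc]

end MinimalIdeal

section FreeCayley

variable {S : Type u} [Semigroup S] {K : Set S}

theorem nonempty_freeSemigroup_greenHClass_mulEquiv (hK : IsSemigroupIdeal K)
    (hR : ∃ a : S, K = greenRClass a) (hH : ∀ a ∈ K, (greenHClass a).Nontrivial)
    (hk : ∃ k ∈ K, ∀ s t : S, s * t = s * k * t) {a : S} (ha : a ∈ K) :
    Nonempty (FreeSemigroup (greenHClass a) ≃* CayleyAutomatonSemigroup S) := by
  obtain ⟨c, rfl⟩ := hR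
  obtain ⟨k, hkc, hk⟩ := hk
  have hkk : IsIdempotentElem (k * k) := by
    rw [IsIdempotentElem, ← mul_assoc, ← hk, ← hk]
  obtain ⟨e, hec, he, hHe, hHa⟩ :=
    exists_greenHClass_eq_corner hK hkk (hK.mul_mem_left k k hkc) ha
  have hleft {b : S} (hb : b ∈ greenRClass c) : e * b = b :=
    mul_eq_of_mem_principalRightIdeal he (mem_principalRightIdeal_of_mem_greenRClass hec hb)
  let : Group (Subsemigroup.corner e) := cornerGroup he hHe.ge
  have : Nontrivial (Subsemigroup.corner e) :=
    Set.nontrivial_coe_sort.mpr (hHe ▸ hH e hec)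
  obtain ⟨φ⟩ := nonempty_freeSemigroup_mulEquiv_of_state_eq
    (f := MulMemClass.subtype (Subsemigroup.corner e)) Subtype.val_injective fun s =>
      ⟨⟨s * e, (Subsemigroup.mem_corner_iff he).mpr
        ⟨hleft (hK.mul_mem_left s e hec), by rw [mul_assoc, he.eq]⟩⟩,
        cayley_state_eq_iff.mpr fun x => calc
          s * e * x = s * (e * k) * x := by rw [hk (s * e) x, mul_assoc s]
          _ = s * x := by rw [hleft hkc, ← hk]⟩
  exact ⟨(freeSemigroupCongr (Equiv.setCongr hHa)).trans φ⟩

theorem mul_idempotent_mul [IsLeftCancelMul (CayleyAutomatonSemigroup S)] {e : S}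
    (he : IsIdempotentElem e) (s t : S) : s * e * t = s * t := by
  have h : cayleyState e * cayleyState (s * e) = cayleyState e * cayleyState s :=
    cayleyState_mul_eq_mul fun x => cayley_act_congr_state (by
      rw [cayley_act_zero, mul_assoc, ← mul_assoc e, he.eq])
  exact cayleyState_eq_iff.mp (mul_left_cancel h) t

theorem idempotent_mul_mul [IsCancelMul (CayleyAutomatonSemigroup S)] {e : S}
    (he : IsIdempotentElem e) (s t : S) : e * s * t = s * t := by
  have h : cayleyState (e * s) * cayleyState e = cayleyState s * cayleyState e :=
    cayleyState_mul_eq_mul fun x => cayley_act_congr_input e fun t n => by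
      rw [cayley_act_mul, ← mul_assoc, mul_idempotent_mul he]
  exact cayleyState_eq_iff.mp (mul_right_cancel h) t

theorem isIdempotentElem_cayleyState {e : S} (he : IsIdempotentElem e)
    (h : ∀ s t, e * s * t = e * t) : IsIdempotentElem (cayleyState e) := by
  have hact (x : ℕ → S) (n : ℕ) : (cayleyAutomaton S).act e x n = e * x n := by
    cases n with
    | zero => rfl
    | succ n =>
      rw [cayley_act_succ, ← he.eq, cayley_act_mul, h, he.eq]
  refine Subtype.ext (congrArg MulOpposite.op (funext fun x => funext fun n => ?_))
  change (cayleyAutomaton S).act e ((cayleyAutomaton S).act e x) n = _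
  rw [hact, ← cayley_act_mul, he.eq]

theorem greenHClass_nontrivial_of_isFreeSemigroup
    (hF : IsFreeSemigroup (CayleyAutomatonSemigroup S)) (hK : IsSemigroupIdeal K) {e : S}
    (hR : K = greenRClass e) (he : IsIdempotentElem e) {a : S} (ha : a ∈ K) :
    (greenHClass a).Nontrivial := by
  have := hF.isCancelMul
  subst hR
  obtain ⟨f, -, hf, -, hHa⟩ := exists_greenHClass_eq_corner hK he rfl ha
  by_contra htriv
  rw [Set.not_nontrivial_iff, hHa] at htriv
  have hfsf (s : S) : f * s * f = f :=
    htriv ⟨s, rfl⟩ ((Subsemigroup.mem_corner_iff hf).mpr ⟨hf, hf⟩)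
  refine hF.not_isIdempotentElem _ (isIdempotentElem_cayleyState hf fun s t => ?_)
  rw [← mul_idempotent_mul hf (f * s), hfsf]

end FreeCayley

theorem proposition4_general {S : Type u} [Semigroup S] {K : Set S} (hK : IsMinimalIdeal K)
    (he : ∃ e ∈ K, IsIdempotentElem e) :
    (IsFreeSemigroup (CayleyAutomatonSemigroup S) ↔
      (∃ a : S, K = greenRClass a) ∧
      (∀ a ∈ K, (greenHClass a).Nontrivial) ∧
      (∃ k ∈ K, ∀ s t : S, s * t = s * k * t)) ∧
    (IsFreeSemigroup (CayleyAutomatonSemigroup S) →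
      ∀ a ∈ K, Nonempty (FreeSemigroup (greenHClass a) ≃* CayleyAutomatonSemigroup S)) := by
  obtain ⟨e, heK, he⟩ := he
  have hconditions (hF : IsFreeSemigroup (CayleyAutomatonSemigroup S)) :
      (∃ a : S, K = greenRClass a) ∧ (∀ a ∈ K, (greenHClass a).Nontrivial) ∧
        (∃ k ∈ K, ∀ s t : S, s * t = s * k * t) := by
    have := hF.isCancelMul
    have hR : K = greenRClass e := hK.eq_greenRClass_of_idempotent_mul
      (fun _ => mul_idempotent_mul) (fun _ => idempotent_mul_mul) he heK
    exact ⟨⟨e, hR⟩, fun _ => greenHClass_nontrivial_of_isFreeSemigroup hF hK.prop hR he,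
      e, heK, fun s t => (mul_idempotent_mul he s t).symm⟩
  refine ⟨⟨hconditions, fun ⟨hR, hH, hk⟩ => ?_⟩, fun hF a ha => ?_⟩
  · exact ⟨_, nonempty_freeSemigroup_greenHClass_mulEquiv hK.prop hR hH hk heK⟩
  · obtain ⟨hR, hH, hk⟩ := hconditions hF
    exact nonempty_freeSemigroup_greenHClass_mulEquiv hK.prop hR hH hk ha

theorem proposition4 {S : Type*} [Semigroup S] [Finite S] [Nonempty S]
    (K : Set S) (hK : IsMinimalIdeal K) :
    (IsFreeSemigroup (CayleyAutomatonSemigroup S) ↔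
      (∃ a : S, K = greenRClass a) ∧
      (∀ a ∈ K, (greenHClass a).Nontrivial) ∧
      (∃ k ∈ K, ∀ s t : S, s * t = s * k * t)) ∧
    (IsFreeSemigroup (CayleyAutomatonSemigroup S) →
      ∀ a ∈ K, IsFreeSemigroupOfRank (CayleyAutomatonSemigroup S) (greenHClass a).ncard) := by
  obtain ⟨hiff, hrank⟩ := proposition4_general hK hK.prop.exists_isIdempotentElem
  exact ⟨hiff, fun hF a ha => (hrank hF a ha).map
    (freeSemigroupCongr (Finite.equivFin (greenHClass a)).symm).trans⟩
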